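/- Let $\alpha,\beta\in\mathbb C$ with $|\alpha|>1$, $|\beta|>1$, and put $$a=\frac{2\log|\alpha|}{\log|\alpha|+\log|\beta|},\qquad b=\frac{2\log|\beta|}{\log|\alpha|+\log|\beta|}.$$ For $z=(z_1,z_2)\in\mathbb C^2\setminus\{0\}$ let $\Phi(z)=\Phi_{\alpha,\beta}(z)$ be the unique positive real number with $$|z_1|^2\,\Phi(z)^{-a}+|z_2|^2\,\Phi(z)^{-b}=1 .$$ Then $\Phi$ is smooth and $\omega_{\alpha,\beta}=\tfrac{i}{2}\partial\bar\partial\Phi$ is the form of a Kähler metric on $\mathbb C^2\setminus\{0\}$ (the Gauduchon–Ornea metric). For a complex Hilbert space $H$ with its flat Kähler form $\omega_0=\tfrac{i}{2}\partial\bar\partial\|\cdot\|^2$, a Kähler immersion of an open set $U\subseteq\mathbb C^2\setminus\{0\}$ into $H$ is a holomorphic map $F\colon U\to H$ with $F^*\omega_0=\omega_{\alpha,\beta}$, and $(\mathbb C^2\setminus\{0\},\omega_{\alpha,\beta})$ admits a local Kähler immersion into $H$ if every point of $\mathbb C^2\setminus\{0\}$ has an open neighbourhood with a Kähler immersion into $H$.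 The Kähler manifold $(\mathbb C^2\setminus\{0\},\omega_{\alpha,\beta})$ admits a local Kähler immersion into $\ell^2(\mathbb C)$ if and only if $|\alpha|=|\beta|$. Moreover, the immersion is then full in $\mathbb C^2$: if $|\alpha|=|\beta|$, then $(\mathbb C^2\setminus\{0\},\omega_{\alpha,\beta})$ admits a local Kähler immersion into $\mathbb C^2$; the image of any Kähler immersion into $\mathbb C^2$ of a non-empty open set is not contained in a proper complex affine subspace of $\mathbb C^2$; and the image of any Kähler immersion into $\ell^2(\mathbb C)$ of a non-empty connected open set spans a complex affine subspace of dimension exactly $2$. -/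

import Mathlib

open scoped ContDiff

noncomputable section

namespace GauduchonOrnea

/-- The complex plane `ℂ²`, with coordinates `z 0`, `z 1`. -/
abbrev C2 : Type := EuclideanSpace ℂ (Fin 2)

/-- The Hilbert space `l²(ℂ)` of square-summable complex sequences. -/
abbrev L2 : Type := lp (fun _ : ℕ => ℂ) 2

/-- The exponent `a = 2 log|α| / (log|α| + log|β|)`; the exponent `b` is `weight β α`. -/
def weight (α β : ℂ) : ℝ :=
  2 * Real.log ‖α‖ / (Real.log ‖α‖ + Real.log ‖β‖)

/-- `t > 0` solves `|z₁|² t^(-a) + |z₂|² t^(-b) = 1`. -/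
def SolvesPotentialEq (α β : ℂ) (z : C2) (t : ℝ) : Prop :=
  0 < t ∧ ‖z 0‖ ^ 2 * t ^ (-weight α β) + ‖z 1‖ ^ 2 * t ^ (-weight β α) = 1

lemma weight_pos {α β : ℂ} (hα : 1 < ‖α‖) (hβ : 1 < ‖β‖) : 0 < weight α β := by
  have h1 := Real.log_pos hα
  have h2 := Real.log_pos hβ
  unfold weight
  positivity

/-- Away from the origin the equation for the potential has exactly one positive solution. -/
theorem existsUnique_solvesPotentialEq {α β : ℂ} (hα : 1 < ‖α‖) (hβ : 1 < ‖β‖)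
    {z : C2} (hz : z ≠ 0) : ∃! t : ℝ, SolvesPotentialEq α β z t := by
  have ha := weight_pos hα hβ
  have hb := weight_pos hβ hα
  unfold SolvesPotentialEq
  generalize weight α β = a at *
  generalize weight β α = b at *
  have hx : 0 ≤ ‖z 0‖ ^ 2 := by positivity
  have hy : 0 ≤ ‖z 1‖ ^ 2 := by positivity
  have hxy : 0 < ‖z 0‖ ^ 2 ∨ 0 < ‖z 1‖ ^ 2 := by
    by_contra! h
    apply hz
    ext i
    fin_cases i
    · simpa using le_antisymm h.1 hx
    · simpa using le_antisymm h.2 hy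
  generalize ‖z 0‖ ^ 2 = x at *
  generalize ‖z 1‖ ^ 2 = y at *
  have anti : ∀ s t : ℝ, 0 < s → s < t →
      x * t ^ (-a) + y * t ^ (-b) < x * s ^ (-a) + y * s ^ (-b) := by
    intro s t hs hst
    have h1 := Real.rpow_lt_rpow_of_neg hs hst (neg_neg_of_pos ha)
    have h2 := Real.rpow_lt_rpow_of_neg hs hst (neg_neg_of_pos hb)
    rcases hxy with h | h
    · have := mul_lt_mul_of_pos_left h1 h
      have := mul_le_mul_of_nonneg_left h2.le hy
      linarith
    · have := mul_lt_mul_of_pos_left h2 h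
      have := mul_le_mul_of_nonneg_left h1.le hx
      linarith
  have hpow : ∀ (c e : ℝ), 0 < c → e ≠ 0 → c * (c ^ e⁻¹) ^ (-e) = 1 := by
    intro c e hc he
    rw [← Real.rpow_mul hc.le, show e⁻¹ * -e = -1 by field_simp, Real.rpow_neg_one]
    field_simp
  have low : ∃ s : ℝ, 0 < s ∧ 1 ≤ x * s ^ (-a) + y * s ^ (-b) := by
    rcases hxy with h | h
    · refine ⟨x ^ a⁻¹, Real.rpow_pos_of_pos h _, ?_⟩
      have h1 := hpow x a h ha.ne'
      have : 0 ≤ y * (x ^ a⁻¹) ^ (-b) := by positivity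
      linarith
    · refine ⟨y ^ b⁻¹, Real.rpow_pos_of_pos h _, ?_⟩
      have h1 := hpow y b h hb.ne'
      have : 0 ≤ x * (y ^ b⁻¹) ^ (-a) := by positivity
      linarith
  have high : ∃ t : ℝ, 0 < t ∧ x * t ^ (-a) + y * t ^ (-b) < 1 := by
    have t1 : Filter.Tendsto (fun t : ℝ => x * t ^ (-a) + y * t ^ (-b)) Filter.atTop
        (nhds (x * 0 + y * 0)) :=
      ((tendsto_rpow_neg_atTop ha).const_mul x).add ((tendsto_rpow_neg_atTop hb).const_mul y)
    have t2 := t1.eventually (gt_mem_nhds (show x * 0 + y * 0 < (1 : ℝ) by simp))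
    obtain ⟨t, h1, h2⟩ := (t2.and (Filter.eventually_gt_atTop 0)).exists
    exact ⟨t, h2, h1⟩
  obtain ⟨s, hs, hs1⟩ := low
  obtain ⟨t, ht, ht1⟩ := high
  have hst : s ≤ t := by
    by_contra! h
    have := anti t s ht h
    linarith
  have hcont : ContinuousOn (fun r : ℝ => x * r ^ (-a) + y * r ^ (-b)) (Set.Icc s t) := by
    intro r hr
    have hr0 : r ≠ 0 := (lt_of_lt_of_le hs hr.1).ne'
    exact ((continuousAt_const.mul (Real.continuousAt_rpow_const r _ (Or.inl hr0))).add
      (continuousAt_const.mul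
        (Real.continuousAt_rpow_const r _ (Or.inl hr0)))).continuousWithinAt
  obtain ⟨r, hr, hr1⟩ := intermediate_value_Icc' hst hcont ⟨ht1.le, hs1⟩
  have hr0 : 0 < r := lt_of_lt_of_le hs hr.1
  have hr2 : x * r ^ (-a) + y * r ^ (-b) = 1 := hr1
  refine ⟨r, ⟨hr0, hr2⟩, ?_⟩
  rintro q ⟨hq0, hq1⟩
  rcases lt_trichotomy q r with h | h | h
  · have := anti q r hq0 h
    linarith
  · exact h
  · have := anti r q hr0 h
    linarith

open Classical in
/-- The Gauduchon–Ornea potential `Φ_{α,β}`: for `|α|, |β| > 1` and `z ≠ 0` the unique positive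
solution `Φ` of `|z₁|² Φ^(-a) + |z₂|² Φ^(-b) = 1` (the value at the origin plays no role). -/
def potential (α β : ℂ) (z : C2) : ℝ :=
  if h : ∃ t : ℝ, SolvesPotentialEq α β z t then h.choose else 0

theorem potential_spec {α β : ℂ} (hα : 1 < ‖α‖) (hβ : 1 < ‖β‖) {z : C2} (hz : z ≠ 0) :
    SolvesPotentialEq α β z (potential α β z) := by
  have h := (existsUnique_solvesPotentialEq hα hβ hz).exists
  unfold potential
  rw [dif_pos h]
  exact h.choose_spec

/-- The real `(1,1)`-form `(i/2) ∂∂̄Φ = (1/4) d(-dΦ ∘ J)` at `z`, evaluated on tangent vectors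
`v, w`: with `B` the real Hessian of `Φ` at `z` it equals `(B(iv, w) - B(v, iw)) / 4`.
For `Φ = ‖z‖²` this is the standard flat Kähler form `∑ dx_j ∧ dy_j`. -/
def kahlerForm (Φ : C2 → ℝ) (z v w : C2) : ℝ :=
  (1 / 4) * (fderiv ℝ (fderiv ℝ Φ) z (Complex.I • v) w
    - fderiv ℝ (fderiv ℝ Φ) z v (Complex.I • w))

/-- `(i/2) ∂∂̄Φ` is the form of a Kähler metric on `U`: `Φ` is smooth on `U` and the symmetric form
`g(v, w) = ω(v, iw)` is positive definite at each point of `U` (closedness and invariance under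
multiplication by `i` are automatic for a form with a smooth potential). -/
def IsKahlerPotentialOn (Φ : C2 → ℝ) (U : Set C2) : Prop :=
  ContDiffOn ℝ ∞ Φ U ∧ ∀ z ∈ U, ∀ v : C2, v ≠ 0 → 0 < kahlerForm Φ z v (Complex.I • v)

/-- The flat Kähler form `(i/2) ∂∂̄‖·‖²` of a complex inner product space, `ω₀(v, w) = Im ⟪v, w⟫`
(the inner product is conjugate-linear in the first entry), so that `ω₀(v, iv) = ‖v‖²`. -/
def flatForm {H : Type*} [NormedAddCommGroup H] [InnerProductSpace ℂ H] (v w : H) : ℝ :=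
  (inner ℂ v w).im

/-- `F` is a Kähler immersion of `(U, (i/2) ∂∂̄Φ)` into the flat space `H`: it is holomorphic on the
open set `U` and pulls the flat Kähler form back to `(i/2) ∂∂̄Φ`. When the latter is nondegenerate,
the differential of `F` is automatically injective. -/
def IsKahlerImmersionOn {H : Type*} [NormedAddCommGroup H] [InnerProductSpace ℂ H]
    (Φ : C2 → ℝ) (U : Set C2) (F : C2 → H) : Prop :=
  IsOpen U ∧ DifferentiableOn ℂ F U ∧
    ∀ z ∈ U, ∀ v w : C2, flatForm (fderiv ℂ F z v) (fderiv ℂ F z w) = kahlerForm Φ z v w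

/-- `(M, (i/2) ∂∂̄Φ)` admits a local Kähler immersion into `H`: every point of `M` has an open
neighbourhood in `M` with a Kähler immersion into `H`. -/
def AdmitsLocalKahlerImmersion (H : Type*) [NormedAddCommGroup H] [InnerProductSpace ℂ H]
    (Φ : C2 → ℝ) (M : Set C2) : Prop :=
  ∀ p ∈ M, ∃ U : Set C2, p ∈ U ∧ U ⊆ M ∧ ∃ F : C2 → H, IsKahlerImmersionOn Φ U F

/-- The image of `U` under `F` is not contained in any proper complex affine subspace of `H`
(these are the complete proper totally geodesic complex submanifolds when `dim H < ∞`). -/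
def IsFullOn {H : Type*} [NormedAddCommGroup H] [InnerProductSpace ℂ H]
    (U : Set C2) (F : C2 → H) : Prop :=
  ∀ S : AffineSubspace ℂ H, F '' U ⊆ S → S = ⊤

end GauduchonOrnea

end

/-!
Write `t = Φ(z)`, `e₁ = t^(-a)`, `e₂ = t^(-b)`, so that `p = e₁ |z₁|²` and `q = e₂ |z₂|²` have sum
`1`, and put `D = a p + b q > 0`, `θ = e₁ z̄₁ v₁ + e₂ z̄₂ v₂`.

*The metric.* In the variable `τ = log t` the defining equation is smooth with `τ`-derivative `-D`,
so `Φ` is smooth by the implicit function theorem. Differentiating the equation twice along the real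
lines in the directions `v` and `iv` gives an explicit formula for `ω(v, iv)`
(`kahlerForm_potential`), and completing the square in it yields
`ω(v, iv) = (t / D) (e₁ e₂ |z₂ v₁ - z₁ v₂ - (a - b) / D * z₁ z₂ θ|² + |θ|² / D)`, which is positive
for `v ≠ 0` (`hermitian_form_pos`).

*Necessity of `|α| = |β|`.* If `F` is a Kähler immersion, then `ω(v, iv) = ‖dF v‖²`, and along a
complex line in the direction `v` this is the squared norm of a vector-valued holomorphic function
of one variable. By the maximum modulus principle it cannot have a strict local maximum
(`IsKahlerImmersionOn.not_eventually_lt`). Since `a + b = 2`, unequal moduli make one exponent less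
than `1`. If `a < 1`, then on the line `z₁ = 1` the squared length of `∂/∂z₂` is
`t^(1-b) (a² p + q D) / D³`, whose value `1 / a` at `z₂ = 0` is a strict local maximum
(`transverse_length_lt`); the case `b < 1` is symmetric.

*The flat case.* If `|α| = |β|`, then `Φ = ‖z‖²`, so linear isometries of `ℂ²` are Kähler
immersions, and every Kähler immersion has isometric differentials. In `ℂ²` such a differential is onto, which
gives fullness. In a Hilbert space, which is strictly convex, the maximum modulus principle in its
strong form shows that the derivative along complex lines is locally constant; so the immersion is
affine on connected open sets (`exists_eq_add_clm`), and its image spans a plane.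
-/

open scoped ContDiff
open Filter Topology

namespace GauduchonOrnea

/-! ### Second derivatives along real lines -/

section

variable {E : Type*} [NormedAddCommGroup E] [NormedSpace ℝ E]

lemma contDiffAt_comp_line {f : E → ℝ} {z : E} (hf : ContDiffAt ℝ 2 f z) (v : E) :
    ContDiffAt ℝ 2 (fun s : ℝ => f (z + s • v)) 0 := by
  have hz : z = z + (0 : ℝ) • v := by simp
  rw [hz] at hf
  exact hf.comp (0 : ℝ) (by fun_prop)

lemma deriv_deriv_comp_line {f : E → ℝ} {z : E} (hf : ContDiffAt ℝ 2 f z) (v : E) :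
    deriv (deriv fun s : ℝ => f (z + s • v)) 0 = fderiv ℝ (fderiv ℝ f) z v v := by
  have hline : ∀ s : ℝ, HasDerivAt (fun s : ℝ => z + s • v) v s := fun s => by
    simpa using ((hasDerivAt_id s).smul_const v).const_add z
  have hz : z = z + (0 : ℝ) • v := by simp
  have hcont : Tendsto (fun s : ℝ => z + s • v) (𝓝 0) (𝓝 z) := by
    have := (hline 0).continuousAt.tendsto
    rwa [← hz] at this
  have hdiff : ∀ᶠ s : ℝ in 𝓝 0, DifferentiableAt ℝ f (z + s • v) :=
    hcont.eventually ((hf.eventually (by simp)).mono fun w hw => hw.differentiableAt two_ne_zero)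
  have hfirst : (deriv fun s : ℝ => f (z + s • v)) =ᶠ[𝓝 0]
      fun s => fderiv ℝ f (z + s • v) v := by
    filter_upwards [hdiff] with s hs
    exact (hs.hasFDerivAt.comp_hasDerivAt s (hline s)).deriv
  rw [hfirst.deriv_eq]
  have h2 : HasFDerivAt (fderiv ℝ f) (fderiv ℝ (fderiv ℝ f) z) (z + (0 : ℝ) • v) := by
    rw [← hz]
    exact ((hf.fderiv_right (m := 1) one_add_one_eq_two.le).differentiableAt
      one_ne_zero).hasFDerivAt
  have h3 : HasDerivAt (fun s : ℝ => fderiv ℝ f (z + s • v)) (fderiv ℝ (fderiv ℝ f) z v) 0 :=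
    h2.comp_hasDerivAt (0 : ℝ) (hline 0)
  have h4 : HasFDerivAt (fun g : E →L[ℝ] ℝ => g v) (ContinuousLinearMap.apply ℝ ℝ v)
      (fderiv ℝ f (z + (0 : ℝ) • v)) := (ContinuousLinearMap.apply ℝ ℝ v).hasFDerivAt
  exact (h4.comp_hasDerivAt (0 : ℝ) h3).deriv

end

/-- Implicit differentiation, twice, of `X T^(-a) + Y T^(-b) = 1`, where `X` and `Y` are the
squared distances `‖z_j + s v_j‖²` along a real line. -/
lemma deriv_deriv_of_solves {T : ℝ → ℝ} {a b x y r₁ r₂ n₁ n₂ : ℝ} (hT : ContDiffAt ℝ 2 T 0)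
    (hpos : ∀ᶠ s in 𝓝 0, 0 < T s)
    (heq : ∀ᶠ s in 𝓝 0, (x + 2 * r₁ * s + n₁ * s ^ 2) * T s ^ (-a)
      + (y + 2 * r₂ * s + n₂ * s ^ 2) * T s ^ (-b) = 1)
    {e₁ e₂ D : ℝ} (he₁ : e₁ = T 0 ^ (-a)) (he₂ : e₂ = T 0 ^ (-b))
    (hD : D = a * (e₁ * x) + b * (e₂ * y)) (hD0 : D ≠ 0) :
    deriv (deriv T) 0 = T 0 / D * (2 * (n₁ * e₁ + n₂ * e₂)
      - 8 * (a * r₁ * e₁ + b * r₂ * e₂) * (r₁ * e₁ + r₂ * e₂) / D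
      + 4 * (a ^ 2 * (e₁ * x) + b ^ 2 * (e₂ * y) + D) * (r₁ * e₁ + r₂ * e₂) ^ 2 / D ^ 2) := by
  have hT0 : 0 < T 0 := hpos.self_of_nhds
  set ℓ : ℝ → ℝ := fun s => Real.log (T s) with hℓdef
  have hℓ : ContDiffAt ℝ 2 ℓ 0 := hT.log hT0.ne'
  have hTℓ : T =ᶠ[𝓝 0] fun s => Real.exp (ℓ s) := by
    filter_upwards [hpos] with s hs
    exact (Real.exp_log hs).symm
  have hℓd : ∀ᶠ s in 𝓝 0, HasDerivAt ℓ (deriv ℓ s) s :=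
    (hℓ.eventually (by simp)).mono fun s hs => (hs.differentiableAt two_ne_zero).hasDerivAt
  have hℓdd : HasDerivAt (deriv ℓ) (deriv (deriv ℓ) 0) 0 :=
    ((hℓ.derivWithin one_add_one_eq_two.le).differentiableAt one_ne_zero).hasDerivAt
  have hX : ∀ x r n s : ℝ, HasDerivAt (fun s : ℝ => x + 2 * r * s + n * s ^ 2)
      (2 * r + 2 * n * s) s := fun x r n s => by
    have := (((hasDerivAt_id s).const_mul (2 * r)).const_add x).add
      (((hasDerivAt_id s).pow 2).const_mul n)
    exact this.congr_deriv (by simp; ring)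
  have hX' : ∀ r n s : ℝ, HasDerivAt (fun s : ℝ => 2 * r + 2 * n * s) (2 * n) s :=
    fun r n s => by simpa using ((hasDerivAt_id s).const_mul (2 * n)).const_add (2 * r)
  have hexp : ∀ c s : ℝ, HasDerivAt ℓ (deriv ℓ s) s →
      HasDerivAt (fun s => Real.exp (-(c * ℓ s))) (Real.exp (-(c * ℓ s)) * -(c * deriv ℓ s)) s :=
    fun c s h => (h.const_mul c).neg.exp
  have heq' : (fun s => (x + 2 * r₁ * s + n₁ * s ^ 2) * Real.exp (-(a * ℓ s))
      + (y + 2 * r₂ * s + n₂ * s ^ 2) * Real.exp (-(b * ℓ s))) =ᶠ[𝓝 0] fun _ => 1 := by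
    filter_upwards [heq, hpos] with s hs hs0
    rw [← hs, Real.rpow_def_of_pos hs0, Real.rpow_def_of_pos hs0, mul_neg, mul_neg,
      mul_comm a, mul_comm b]
  -- The first derivative of the constraint vanishes near `0`, so it may be differentiated again.
  have hder : (fun s =>
      ((2 * r₁ + 2 * n₁ * s) * Real.exp (-(a * ℓ s)) + (x + 2 * r₁ * s + n₁ * s ^ 2) *
        (Real.exp (-(a * ℓ s)) * -(a * deriv ℓ s))) +
      ((2 * r₂ + 2 * n₂ * s) * Real.exp (-(b * ℓ s)) + (y + 2 * r₂ * s + n₂ * s ^ 2) *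
        (Real.exp (-(b * ℓ s)) * -(b * deriv ℓ s)))) =ᶠ[𝓝 0] fun _ => 0 := by
    filter_upwards [heq'.deriv, hℓd] with s hs hd
    rw [← (((hX x r₁ n₁ s).mul (hexp a s hd)).add ((hX y r₂ n₂ s).mul (hexp b s hd))).deriv]
    exact hs.trans (deriv_const _ _)
  have hE₁ : Real.exp (-(a * ℓ 0)) = e₁ := by
    rw [he₁, Real.rpow_def_of_pos hT0, mul_neg, mul_comm a]
  have hE₂ : Real.exp (-(b * ℓ 0)) = e₂ := by
    rw [he₂, Real.rpow_def_of_pos hT0, mul_neg, mul_comm b]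
  have hd0 := hℓd.self_of_nhds
  have h1 := hder.self_of_nhds
  have hder2 := ((((hX' r₁ n₁ 0).mul (hexp a 0 hd0)).add ((hX x r₁ n₁ 0).mul
      ((hexp a 0 hd0).mul ((hℓdd.const_mul a).neg)))).add
    (((hX' r₂ n₂ 0).mul (hexp b 0 hd0)).add ((hX y r₂ n₂ 0).mul
      ((hexp b 0 hd0).mul ((hℓdd.const_mul b).neg))))).deriv
  have h2 := hder2.symm.trans (hder.deriv_eq.trans (deriv_const _ _))
  have hT2 : deriv (deriv T) 0 = T 0 * (deriv (deriv ℓ) 0 + deriv ℓ 0 ^ 2) := by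
    have h3 : deriv T =ᶠ[𝓝 0] fun s => Real.exp (ℓ s) * deriv ℓ s := by
      filter_upwards [hTℓ.deriv, hℓd] with s hs hd
      rw [hs, hd.exp.deriv]
    rw [h3.deriv_eq, hTℓ.self_of_nhds]
    exact (hd0.exp.mul hℓdd).deriv.trans (by ring)
  simp only [Pi.mul_apply, Pi.neg_apply, hE₁, hE₂] at h1 h2
  rw [hT2, mul_div_assoc, mul_div_assoc]
  generalize deriv (deriv ℓ) 0 = ℓ₂ at *
  generalize deriv ℓ 0 = ℓ₁ at *
  have hℓ₁ : ℓ₁ = 2 * (r₁ * e₁ + r₂ * e₂) / D := by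
    rw [eq_div_iff hD0, hD]
    linear_combination -h1
  have hℓ₂ : ℓ₂ = (2 * (n₁ * e₁ + n₂ * e₂) - 4 * ℓ₁ * (a * r₁ * e₁ + b * r₂ * e₂)
      + ℓ₁ ^ 2 * (a ^ 2 * (e₁ * x) + b ^ 2 * (e₂ * y))) / D := by
    rw [eq_div_iff hD0, hD]
    linear_combination -h2
  rw [hℓ₂, hℓ₁]
  field_simp
  ring

/-! ### Smoothness of the potential -/

lemma weight_add_weight {α β : ℂ} (hα : 1 < ‖α‖) (hβ : 1 < ‖β‖) :
    weight α β + weight β α = 2 := by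
  have h1 := Real.log_pos hα
  have h2 := Real.log_pos hβ
  unfold weight
  field_simp
  ring

lemma potential_eq_of_solves {α β : ℂ} (hα : 1 < ‖α‖) (hβ : 1 < ‖β‖) {z : C2} (hz : z ≠ 0)
    {t : ℝ} (ht : SolvesPotentialEq α β z t) : potential α β z = t :=
  (existsUnique_solvesPotentialEq hα hβ hz).unique (potential_spec hα hβ hz) ht

lemma normSq_coord_pos_or {z : C2} (hz : z ≠ 0) : 0 < ‖z 0‖ ^ 2 ∨ 0 < ‖z 1‖ ^ 2 := by
  by_contra! h
  apply hz
  ext i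
  fin_cases i
  · simpa using le_antisymm h.1 (by positivity)
  · simpa using le_antisymm h.2 (by positivity)

/-- The factor `a |z₁|² t^(-a) + b |z₂|² t^(-b)` by which the derivative of the defining equation
in `t` differs from `-1 / t`. -/
lemma weighted_sum_pos {a b x y e₁ e₂ : ℝ} (ha : 0 < a) (hb : 0 < b) (he₁ : 0 < e₁) (he₂ : 0 < e₂)
    (hx : 0 ≤ x) (hy : 0 ≤ y) (hxy : 0 < x ∨ 0 < y) : 0 < a * (e₁ * x) + b * (e₂ * y) := by
  rcases hxy with h | h
  · have : 0 ≤ b * (e₂ * y) := by positivity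
    have : 0 < a * (e₁ * x) := by positivity
    linarith
  · have : 0 < b * (e₂ * y) := by positivity
    have : 0 ≤ a * (e₁ * x) := by positivity
    linarith

lemma contDiff_normSq_coord (i : Fin 2) : ContDiff ℝ ∞ fun z : C2 => ‖z i‖ ^ 2 :=
  (contDiff_norm_sq ℂ).comp
    ((EuclideanSpace.proj i : C2 →L[ℂ] ℂ).restrictScalars ℝ).contDiff

lemma contDiffAt_potential {α β : ℂ} (hα : 1 < ‖α‖) (hβ : 1 < ‖β‖) {z : C2} (hz : z ≠ 0) :
    ContDiffAt ℝ ∞ (potential α β) z := by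
  have ha := weight_pos hα hβ
  have hb := weight_pos hβ hα
  obtain ⟨ht, hteq⟩ := potential_spec hα hβ hz
  set a := weight α β with ha'
  set b := weight β α with hb'
  set t := potential α β z
  -- In the variable `τ = log t` the equation is smooth everywhere.
  set G : C2 × ℝ → ℝ := fun u =>
    ‖u.1 0‖ ^ 2 * Real.exp (-(a * u.2)) + ‖u.1 1‖ ^ 2 * Real.exp (-(b * u.2)) with hG
  set u : C2 × ℝ := (z, Real.log t) with hu
  have hrpow : ∀ c τ : ℝ, Real.exp τ ^ (-c) = Real.exp (-(c * τ)) := fun c τ => by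
    rw [← Real.exp_mul, mul_neg, mul_comm]
  have hGu : G u = 1 := by
    rw [← hteq, ← Real.exp_log ht, hrpow, hrpow]
  have hGs : ContDiff ℝ ∞ G := by
    have h0 := (contDiff_normSq_coord 0).comp (contDiff_fst (𝕜 := ℝ) (E := C2) (F := ℝ) (n := ∞))
    have h1 := (contDiff_normSq_coord 1).comp (contDiff_fst (𝕜 := ℝ) (E := C2) (F := ℝ) (n := ∞))
    have h2 : ∀ c : ℝ, ContDiff ℝ ∞ fun u : C2 × ℝ => Real.exp (-(c * u.2)) := fun c => by fun_prop
    exact (h0.mul (h2 a)).add (h1.mul (h2 b))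
  have hGc : ContDiffAt ℝ ∞ G u := hGs.contDiffAt
  -- The partial derivative in `τ` is multiplication by the nonzero number `-D`.
  have hinv : (fderiv ℝ G u ∘L .inr ℝ C2 ℝ).IsInvertible := by
    have hexp : ∀ c τ : ℝ, HasDerivAt (fun τ => Real.exp (-(c * τ)))
        (Real.exp (-(c * τ)) * -(c * 1)) τ := fun c τ =>
      (((hasDerivAt_id τ).const_mul c).neg).exp
    have h1 : HasDerivAt (fun τ : ℝ => G (z, τ))
        (‖z 0‖ ^ 2 * (Real.exp (-(a * Real.log t)) * -(a * 1))
          + ‖z 1‖ ^ 2 * (Real.exp (-(b * Real.log t)) * -(b * 1))) (Real.log t) :=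
      ((hexp a _).const_mul (‖z 0‖ ^ 2)).add ((hexp b _).const_mul (‖z 1‖ ^ 2))
    have h2 : HasDerivAt (fun τ : ℝ => (z, τ)) ((0 : C2), (1 : ℝ)) (Real.log t) :=
      (hasDerivAt_const _ z).prodMk (hasDerivAt_id _)
    have h3 := ((hGs.differentiable (by simp)).differentiableAt (x := u)).hasFDerivAt
      |>.comp_hasDerivAt (Real.log t) h2
    have h4 := h3.unique h1
    have h5 := weighted_sum_pos ha hb (Real.exp_pos (-(a * Real.log t)))
      (Real.exp_pos (-(b * Real.log t))) (sq_nonneg ‖z 0‖) (sq_nonneg ‖z 1‖)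
      (normSq_coord_pos_or hz)
    have h6 : (fderiv ℝ G u ∘L .inr ℝ C2 ℝ) 1 ≠ 0 := by
      simp only [ContinuousLinearMap.comp_apply, ContinuousLinearMap.inr_apply]
      rw [h4]
      intro h
      linarith
    refine ⟨ContinuousLinearEquiv.unitsEquivAut ℝ (Units.mk0 _ h6), ?_⟩
    ext
    simp
  have hψ := hGc.contDiffAt_implicitFunction (by simp) hinv
  refine hψ.exp.congr_of_eventuallyEq ?_
  filter_upwards [hGc.eventually_apply_implicitFunction (by simp) hinv,
    isOpen_ne.mem_nhds hz] with w hw hw0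
  refine potential_eq_of_solves hα hβ hw0 ⟨Real.exp_pos _, ?_⟩
  rw [hrpow, hrpow, ← hGu, ← hw]

lemma potential_pos {α β : ℂ} (hα : 1 < ‖α‖) (hβ : 1 < ‖β‖) {z : C2} (hz : z ≠ 0) :
    0 < potential α β z :=
  (potential_spec hα hβ hz).1

/-! ### The Kähler form of the potential -/

lemma kahlerForm_smul_I (Φ : C2 → ℝ) (z v : C2) :
    kahlerForm Φ z v (Complex.I • v) = (1 / 4) * (fderiv ℝ (fderiv ℝ Φ) z v v
      + fderiv ℝ (fderiv ℝ Φ) z (Complex.I • v) (Complex.I • v)) := by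
  have h : Complex.I • Complex.I • v = -v := by
    rw [smul_smul, Complex.I_mul_I, neg_one_smul]
  unfold kahlerForm
  rw [h, map_neg]
  ring

lemma normSq_add_smul (x w : ℂ) (s : ℝ) :
    ‖x + s • w‖ ^ 2 = ‖x‖ ^ 2 + 2 * (starRingEnd ℂ x * w).re * s + ‖w‖ ^ 2 * s ^ 2 := by
  simp only [← Complex.normSq_eq_norm_sq, Complex.normSq_apply]
  simp
  ring

/-- The second derivative of the potential in the direction `v`. -/
lemma hessian_potential {α β : ℂ} (hα : 1 < ‖α‖) (hβ : 1 < ‖β‖) {z : C2} (hz : z ≠ 0) (v : C2)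
    {a b t e₁ e₂ D : ℝ} (ha : a = weight α β) (hb : b = weight β α) (ht : t = potential α β z)
    (he₁ : e₁ = t ^ (-a)) (he₂ : e₂ = t ^ (-b))
    (hD : D = a * (e₁ * ‖z 0‖ ^ 2) + b * (e₂ * ‖z 1‖ ^ 2)) (hD0 : D ≠ 0) {r₁ r₂ : ℝ}
    (hr₁ : r₁ = (starRingEnd ℂ (z 0) * v 0).re) (hr₂ : r₂ = (starRingEnd ℂ (z 1) * v 1).re) :
    fderiv ℝ (fderiv ℝ (potential α β)) z v v
      = t / D * (2 * (‖v 0‖ ^ 2 * e₁ + ‖v 1‖ ^ 2 * e₂)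
      - 8 * (a * r₁ * e₁ + b * r₂ * e₂) * (r₁ * e₁ + r₂ * e₂) / D
      + 4 * (a ^ 2 * (e₁ * ‖z 0‖ ^ 2) + b ^ 2 * (e₂ * ‖z 1‖ ^ 2) + D)
        * (r₁ * e₁ + r₂ * e₂) ^ 2 / D ^ 2) := by
  have hsm : ContDiffAt ℝ 2 (potential α β) z :=
    (contDiffAt_potential hα hβ hz).of_le (WithTop.coe_le_coe.2 (le_top : (2 : ℕ∞) ≤ ⊤))
  have hne : ∀ᶠ s : ℝ in 𝓝 0, z + s • v ≠ 0 := by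
    have : ContinuousAt (fun s : ℝ => z + s • v) 0 := by fun_prop
    exact this.eventually_ne (by simpa using hz)
  have h0 : t = potential α β (z + (0 : ℝ) • v) := by simpa using ht
  have key := deriv_deriv_of_solves (a := a) (b := b) (x := ‖z 0‖ ^ 2) (y := ‖z 1‖ ^ 2)
    (r₁ := r₁) (r₂ := r₂) (n₁ := ‖v 0‖ ^ 2) (n₂ := ‖v 1‖ ^ 2) (e₁ := e₁) (e₂ := e₂) (D := D)
    (contDiffAt_comp_line hsm v) (hne.mono fun s hs => potential_pos hα hβ hs)
    (hne.mono fun s hs => by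
      have h := (potential_spec hα hβ hs).2
      rw [PiLp.add_apply, PiLp.add_apply, PiLp.smul_apply, PiLp.smul_apply, normSq_add_smul,
        normSq_add_smul] at h
      rw [hr₁, hr₂, ha, hb]
      exact h)
    (by rw [he₁, h0]) (by rw [he₂, h0]) hD hD0
  rw [← h0, deriv_deriv_comp_line hsm] at key
  exact key

lemma kahlerForm_potential {α β : ℂ} (hα : 1 < ‖α‖) (hβ : 1 < ‖β‖) {z : C2} (hz : z ≠ 0) (v : C2)
    {a b t e₁ e₂ D : ℝ} (ha : a = weight α β) (hb : b = weight β α) (ht : t = potential α β z)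
    (he₁ : e₁ = t ^ (-a)) (he₂ : e₂ = t ^ (-b))
    (hD : D = a * (e₁ * ‖z 0‖ ^ 2) + b * (e₂ * ‖z 1‖ ^ 2)) (hD0 : D ≠ 0) {m₁ m₂ : ℂ}
    (hm₁ : m₁ = starRingEnd ℂ (z 0) * v 0) (hm₂ : m₂ = starRingEnd ℂ (z 1) * v 1) :
    kahlerForm (potential α β) z v (Complex.I • v)
      = t / D * (‖v 0‖ ^ 2 * e₁ + ‖v 1‖ ^ 2 * e₂
      - 2 * ((a * m₁.re * e₁ + b * m₂.re * e₂) * (m₁.re * e₁ + m₂.re * e₂)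
        + (a * m₁.im * e₁ + b * m₂.im * e₂) * (m₁.im * e₁ + m₂.im * e₂)) / D
      + (a ^ 2 * (e₁ * ‖z 0‖ ^ 2) + b ^ 2 * (e₂ * ‖z 1‖ ^ 2) + D)
        * ((m₁.re * e₁ + m₂.re * e₂) ^ 2 + (m₁.im * e₁ + m₂.im * e₂) ^ 2) / D ^ 2) := by
  have him : ∀ x w : ℂ, -(starRingEnd ℂ x * w).im = (starRingEnd ℂ x * (Complex.I * w)).re :=
    fun x w => by simp; ring
  have hnorm : ∀ w : ℂ, ‖Complex.I * w‖ = ‖w‖ := fun w => by simp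
  rw [kahlerForm_smul_I,
    hessian_potential hα hβ hz v ha hb ht he₁ he₂ hD hD0 (r₁ := m₁.re) (r₂ := m₂.re)
      (by rw [hm₁]) (by rw [hm₂]),
    hessian_potential hα hβ hz (Complex.I • v) ha hb ht he₁ he₂ hD hD0
      (r₁ := -m₁.im) (r₂ := -m₂.im) (by rw [hm₁, him]; rfl) (by rw [hm₂, him]; rfl)]
  simp only [PiLp.smul_apply, smul_eq_mul, hnorm]
  ring

/-- Completing the square in the Hermitian form of the Kähler metric: with `p + q = 1`,
`θ = e₁ z̄₁ v₁ + e₂ z̄₂ v₂` and `δ = z₂ v₁ - z₁ v₂`, the form equals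
`e₁ e₂ |δ - (a - b) / D * z₁ z₂ θ|² + |θ|² / D`. -/
lemma hermitian_form_pos {a b e₁ e₂ D : ℝ} (he₁ : 0 < e₁) (he₂ : 0 < e₂) (hD0 : 0 < D)
    {z₁ z₂ v₁ v₂ m₁ m₂ : ℂ} (hv : v₁ ≠ 0 ∨ v₂ ≠ 0)
    (hpq : e₁ * ‖z₁‖ ^ 2 + e₂ * ‖z₂‖ ^ 2 = 1)
    (hD : D = a * (e₁ * ‖z₁‖ ^ 2) + b * (e₂ * ‖z₂‖ ^ 2))
    (hm₁ : m₁ = starRingEnd ℂ z₁ * v₁) (hm₂ : m₂ = starRingEnd ℂ z₂ * v₂) :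
    0 < ‖v₁‖ ^ 2 * e₁ + ‖v₂‖ ^ 2 * e₂
      - 2 * ((a * m₁.re * e₁ + b * m₂.re * e₂) * (m₁.re * e₁ + m₂.re * e₂)
        + (a * m₁.im * e₁ + b * m₂.im * e₂) * (m₁.im * e₁ + m₂.im * e₂)) / D
      + (a ^ 2 * (e₁ * ‖z₁‖ ^ 2) + b ^ 2 * (e₂ * ‖z₂‖ ^ 2) + D)
        * ((m₁.re * e₁ + m₂.re * e₂) ^ 2 + (m₁.im * e₁ + m₂.im * e₂) ^ 2) / D ^ 2 := by
  set θ : ℂ := e₁ * m₁ + e₂ * m₂ with hθ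
  set δ : ℂ := z₂ * v₁ - z₁ * v₂ with hδ
  set c : ℂ := δ - ((a - b) / D : ℝ) * (z₁ * z₂ * θ) with hc
  -- Lagrange's identity, in the rescaled metric in which `z` is a unit vector.
  have hlag : (e₁ * ‖v₁‖ ^ 2 + e₂ * ‖v₂‖ ^ 2) * (e₁ * ‖z₁‖ ^ 2 + e₂ * ‖z₂‖ ^ 2)
      = ‖θ‖ ^ 2 + e₁ * e₂ * ‖δ‖ ^ 2 := by
    simp only [hθ, hδ, hm₁, hm₂, ← Complex.normSq_eq_norm_sq, Complex.normSq_apply]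
    simp
    ring
  rw [hpq, mul_one] at hlag
  have key : ‖v₁‖ ^ 2 * e₁ + ‖v₂‖ ^ 2 * e₂
      - 2 * ((a * m₁.re * e₁ + b * m₂.re * e₂) * (m₁.re * e₁ + m₂.re * e₂)
        + (a * m₁.im * e₁ + b * m₂.im * e₂) * (m₁.im * e₁ + m₂.im * e₂)) / D
      + (a ^ 2 * (e₁ * ‖z₁‖ ^ 2) + b ^ 2 * (e₂ * ‖z₂‖ ^ 2) + D)
        * ((m₁.re * e₁ + m₂.re * e₂) ^ 2 + (m₁.im * e₁ + m₂.im * e₂) ^ 2) / D ^ 2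
      = e₁ * e₂ * ‖c‖ ^ 2 + ‖θ‖ ^ 2 / D := by
    have hsq : (a ^ 2 * (e₁ * ‖z₁‖ ^ 2) + b ^ 2 * (e₂ * ‖z₂‖ ^ 2))
        * (e₁ * ‖z₁‖ ^ 2 + e₂ * ‖z₂‖ ^ 2)
        = D ^ 2 + (a - b) ^ 2 * (e₁ * ‖z₁‖ ^ 2) * (e₂ * ‖z₂‖ ^ 2) := by
      rw [hD]; ring
    have hcross : ((a * m₁.re * e₁ + b * m₂.re * e₂) * (m₁.re * e₁ + m₂.re * e₂)
        + (a * m₁.im * e₁ + b * m₂.im * e₂) * (m₁.im * e₁ + m₂.im * e₂))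
        * (e₁ * ‖z₁‖ ^ 2 + e₂ * ‖z₂‖ ^ 2)
        = D * ‖θ‖ ^ 2 + (a - b) * (e₁ * e₂ * (δ * starRingEnd ℂ (z₁ * z₂ * θ)).re) := by
      rw [hD]
      simp only [hθ, hδ, hm₁, hm₂, ← Complex.normSq_eq_norm_sq, Complex.normSq_apply]
      simp
      ring
    have hcn : ‖c‖ ^ 2 = ‖δ‖ ^ 2 - 2 * ((a - b) / D) * (δ * starRingEnd ℂ (z₁ * z₂ * θ)).re
        + ((a - b) / D) ^ 2 * (‖z₁‖ ^ 2 * ‖z₂‖ ^ 2 * ‖θ‖ ^ 2) := by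
      rw [hc, ← mul_pow, ← mul_pow, ← norm_mul, ← norm_mul]
      generalize z₁ * z₂ * θ = ξ
      simp only [← Complex.normSq_eq_norm_sq, Complex.normSq_apply]
      simp
      ring
    have hθn : (m₁.re * e₁ + m₂.re * e₂) ^ 2 + (m₁.im * e₁ + m₂.im * e₂) ^ 2 = ‖θ‖ ^ 2 := by
      rw [← Complex.normSq_eq_norm_sq, Complex.normSq_apply, hθ]
      simp
      ring
    rw [hpq, mul_one] at hsq hcross
    rw [hθn, hcross, hsq, hcn]
    have : ‖v₁‖ ^ 2 * e₁ + ‖v₂‖ ^ 2 * e₂ = ‖θ‖ ^ 2 + e₁ * e₂ * ‖δ‖ ^ 2 := by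
      rw [← hlag]; ring
    rw [this]
    have := hD0.ne'
    field_simp
    ring
  rw [key]
  by_cases h : θ = 0
  · have hcδ : c = δ := by rw [hc, h]; simp
    have hδ0 : δ ≠ 0 := by
      intro h0
      rw [h, h0, norm_zero] at hlag
      rcases hv with h1 | h1
      · have : 0 < e₁ * ‖v₁‖ ^ 2 := by positivity
        have : 0 ≤ e₂ * ‖v₂‖ ^ 2 := by positivity
        linarith
      · have : 0 < e₂ * ‖v₂‖ ^ 2 := by positivity
        have : 0 ≤ e₁ * ‖v₁‖ ^ 2 := by positivity
        linarith
    rw [hcδ, h]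
    have : 0 < e₁ * e₂ * ‖δ‖ ^ 2 := by positivity
    simpa using this
  · positivity

theorem isKahlerPotentialOn_potential {α β : ℂ} (hα : 1 < ‖α‖) (hβ : 1 < ‖β‖) :
    IsKahlerPotentialOn (potential α β) {z : C2 | z ≠ 0} := by
  refine ⟨fun z hz => (contDiffAt_potential hα hβ hz).contDiffWithinAt, fun z hz v hv => ?_⟩
  obtain ⟨ht, heq⟩ := potential_spec hα hβ hz
  have he₁ : 0 < potential α β z ^ (-weight α β) := by positivity
  have he₂ : 0 < potential α β z ^ (-weight β α) := by positivity
  have hD0 := weighted_sum_pos (weight_pos hα hβ) (weight_pos hβ hα) he₁ he₂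
    (sq_nonneg ‖z 0‖) (sq_nonneg ‖z 1‖) (normSq_coord_pos_or hz)
  rw [kahlerForm_potential hα hβ hz v rfl rfl rfl rfl rfl rfl hD0.ne' rfl rfl]
  refine mul_pos (div_pos ht hD0) (hermitian_form_pos he₁ he₂ hD0 ?_ ?_ rfl rfl rfl)
  · by_contra! h
    apply hv
    ext i
    fin_cases i
    · exact h.1
    · exact h.2
  · rw [← heq]; ring

/-! ### Kähler immersions along complex lines -/

section

variable {H : Type*} [NormedAddCommGroup H] [InnerProductSpace ℂ H]

lemma flatForm_smul_I (w : H) : flatForm w (Complex.I • w) = ‖w‖ ^ 2 := by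
  unfold flatForm
  rw [inner_smul_right, inner_self_eq_norm_sq_to_K]
  simp [← Complex.ofReal_pow]

lemma IsKahlerImmersionOn.normSq_fderiv {Φ : C2 → ℝ} {U : Set C2} {F : C2 → H}
    (hF : IsKahlerImmersionOn Φ U F) {z : C2} (hz : z ∈ U) (v : C2) :
    ‖fderiv ℂ F z v‖ ^ 2 = kahlerForm Φ z v (Complex.I • v) := by
  rw [← hF.2.2 z hz, map_smul, flatForm_smul_I]

lemma hasDerivAt_comp_complexLine {U : Set C2} {F : C2 → H} (hU : IsOpen U)
    (hF : DifferentiableOn ℂ F U) {z v : C2} {s : ℂ} (hs : z + s • v ∈ U) :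
    HasDerivAt (fun s : ℂ => F (z + s • v)) (fderiv ℂ F (z + s • v) v) s := by
  have hline : HasDerivAt (fun s : ℂ => z + s • v) v s := by
    simpa using ((hasDerivAt_id s).smul_const v).const_add z
  exact (hF.differentiableAt (hU.mem_nhds hs)).hasFDerivAt.comp_hasDerivAt s hline

lemma isOpen_complexLine_preimage {U : Set C2} (hU : IsOpen U) (z v : C2) :
    IsOpen {s : ℂ | z + s • v ∈ U} :=
  hU.preimage (by fun_prop)

lemma differentiableOn_fderiv_comp_complexLine [CompleteSpace H] {U : Set C2} {F : C2 → H}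
    (hU : IsOpen U) (hF : DifferentiableOn ℂ F U) (z v : C2) :
    DifferentiableOn ℂ (fun s : ℂ => fderiv ℂ F (z + s • v) v) {s : ℂ | z + s • v ∈ U} := by
  have h : DifferentiableOn ℂ (fun s : ℂ => F (z + s • v)) {s : ℂ | z + s • v ∈ U} :=
    fun s hs => (hasDerivAt_comp_complexLine hU hF hs).differentiableAt.differentiableWithinAt
  exact (h.deriv (isOpen_complexLine_preimage hU z v)).congr
    fun s hs => (hasDerivAt_comp_complexLine hU hF hs).deriv.symm

/-- The squared length `‖dF v‖²` of a fixed vector is the squared norm of a holomorphic function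
on each complex line, so by the maximum modulus principle it has no strict local maximum there. -/
lemma IsKahlerImmersionOn.not_eventually_lt [CompleteSpace H] {Φ : C2 → ℝ} {U : Set C2}
    {F : C2 → H} (hF : IsKahlerImmersionOn Φ U F) {z : C2} (hz : z ∈ U) (v : C2) :
    ¬ ∀ᶠ s : ℂ in 𝓝[≠] 0, kahlerForm Φ (z + s • v) v (Complex.I • v)
      < kahlerForm Φ z v (Complex.I • v) := by
  intro hlt
  have hmem : {s : ℂ | z + s • v ∈ U} ∈ 𝓝 (0 : ℂ) :=
    (isOpen_complexLine_preimage hF.1 z v).mem_nhds (by simpa using hz)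
  have hd := (differentiableOn_fderiv_comp_complexLine hF.1 hF.2.1 z v).eventually_differentiableAt
    hmem
  have hlt' : ∀ᶠ s : ℂ in 𝓝[≠] 0,
      ‖fderiv ℂ F (z + s • v) v‖ < ‖fderiv ℂ F (z + (0 : ℂ) • v) v‖ := by
    filter_upwards [hlt, mem_nhdsWithin_of_mem_nhds hmem] with s hs hsU
    rw [← hF.normSq_fderiv hsU, ← hF.normSq_fderiv hz] at hs
    rw [zero_smul, add_zero]
    exact lt_of_pow_lt_pow_left₀ 2 (norm_nonneg _) hs
  have hmax : IsLocalMax (norm ∘ fun s : ℂ => fderiv ℂ F (z + s • v) v) 0 := by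
    have := eventually_nhdsWithin_iff.1 hlt'
    filter_upwards [this] with s hs
    by_cases h : s = 0
    · rw [h]
    · exact (hs h).le
  have hconst := Complex.norm_eventually_eq_of_isLocalMax hd hmax
  obtain ⟨s, h1, h2⟩ := (hlt'.and (hconst.filter_mono nhdsWithin_le_nhds)).exists
  exact h1.ne h2

end

/-! ### The obstruction when the moduli differ -/

/-- The squared transverse length along the coordinate axis of the smaller exponent `a < 1`: with
`q = e₂ y` it equals `t^(1-b) (a² (1 - q) + q D) / D³`, which is less than its value `1 / a`
at `q = 0`. -/
lemma transverse_length_lt {a b t y e₁ e₂ D : ℝ} (ha : 0 < a) (ha1 : a < 1) (hab : a + b = 2)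
    (ht : 0 < t) (he₁ : e₁ = t ^ (-a)) (he₂ : e₂ = t ^ (-b)) (hy : 0 < y) (hya : y < a)
    (heq : e₁ + e₂ * y = 1) (hD : D = a * e₁ + b * (e₂ * y)) :
    t / D * (e₂ - 2 * (b * e₂ * e₂ * y) / D + (a ^ 2 * e₁ + b ^ 2 * (e₂ * y) + D)
      * (e₂ ^ 2 * y) / D ^ 2) < 1 / a := by
  have he₁0 : 0 < e₁ := by rw [he₁]; positivity
  have he₂0 : 0 < e₂ := by rw [he₂]; positivity
  have hb : b = 2 - a := by linarith
  have ht1 : 1 ≤ t := by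
    by_contra! h
    have := Real.one_lt_rpow_of_pos_of_lt_one_of_neg ht h (neg_neg_of_pos ha)
    have : 0 < e₂ * y := by positivity
    linarith
  have hte : t * e₂ ≤ 1 := by
    have : t * e₂ = t ^ (a - 1) := by
      rw [he₂, show a - 1 = 1 + -b by linarith, Real.rpow_add ht, Real.rpow_one]
    rw [this]
    exact Real.rpow_le_one_of_one_le_of_nonpos ht1 (by linarith)
  have he₂1 : e₂ ≤ 1 := by
    rw [he₂]
    exact Real.rpow_le_one_of_one_le_of_nonpos ht1 (by linarith)
  obtain ⟨q, hq⟩ : ∃ q, q = e₂ * y := ⟨_, rfl⟩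
  have hq0 : 0 < q := by rw [hq]; positivity
  have hqa : q < a := by
    rw [hq]
    exact (mul_le_of_le_one_left hy.le he₂1).trans_lt hya
  have hDq : D = a + 2 * (1 - a) * q := by
    rw [hD, ← hq, show e₁ = 1 - q by linarith, hb]
    ring
  have hε : 0 < 1 - a := by linarith
  have hD0 : 0 < D := by rw [hDq]; positivity
  have hval : t / D * (e₂ - 2 * (b * e₂ * e₂ * y) / D + (a ^ 2 * e₁ + b ^ 2 * (e₂ * y) + D)
      * (e₂ ^ 2 * y) / D ^ 2) = t * e₂ * ((a ^ 2 * (1 - q) + q * D) / D ^ 3) := by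
    have h1 : e₂ ^ 2 * y = e₂ * q := by rw [hq]; ring
    have h2 : b * e₂ * e₂ * y = b * e₂ * q := by rw [hq]; ring
    rw [h1, h2, ← hq, show e₁ = 1 - q by linarith]
    field_simp
    rw [hDq, hb]
    ring
  have hpos : 0 ≤ (a ^ 2 * (1 - q) + q * D) / D ^ 3 := by
    have : 0 < 1 - q := by linarith
    positivity
  rw [hval]
  refine (mul_le_of_le_one_left hpos hte).trans_lt ?_
  rw [div_lt_div_iff₀ (by positivity) ha, hDq]
  have h1 : 0 < (1 - a) * q * a * (a - q) := by
    have : 0 < a - q := by linarith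
    positivity
  have h2 : 0 < (1 - a) ^ 3 * q ^ 3 := by positivity
  have h3 : 0 < a * (1 - a) ^ 2 * q ^ 2 := by positivity
  have h4 : 0 < a ^ 2 * (1 - a) * q := by positivity
  linear_combination 2 * h1 + 8 * h2 + 12 * h3 + 3 * h4

lemma solvesPotentialEq_one_zero {α β : ℂ} :
    SolvesPotentialEq α β (EuclideanSpace.single 0 1) 1 := by
  simp [SolvesPotentialEq]

lemma solvesPotentialEq_zero_one {α β : ℂ} :
    SolvesPotentialEq α β (EuclideanSpace.single 1 1) 1 := by
  simp [SolvesPotentialEq]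

lemma eventually_normSq_lt {a : ℝ} (ha : 0 < a) :
    ∀ᶠ s : ℂ in 𝓝[≠] 0, 0 < ‖s‖ ^ 2 ∧ ‖s‖ ^ 2 < a := by
  have h : Tendsto (fun s : ℂ => ‖s‖ ^ 2) (𝓝[≠] 0) (𝓝 0) := by
    have : Continuous fun s : ℂ => ‖s‖ ^ 2 := by fun_prop
    simpa using (this.tendsto 0).mono_left nhdsWithin_le_nhds
  filter_upwards [h.eventually_lt_const ha, self_mem_nhdsWithin] with s hs hs0
  exact ⟨by have : s ≠ 0 := hs0; positivity, hs⟩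

/-- If `a < 1`, the squared length of `∂/∂z₂` on the line `z₁ = 1` has a strict local maximum at
`z₂ = 0`. -/
lemma eventually_kahlerForm_lt_of_weight_lt_one {α β : ℂ} (hα : 1 < ‖α‖) (hβ : 1 < ‖β‖)
    (h : weight α β < 1) :
    ∀ᶠ s : ℂ in 𝓝[≠] 0,
      kahlerForm (potential α β) (EuclideanSpace.single 0 1 + s • EuclideanSpace.single 1 1)
        (EuclideanSpace.single 1 1) (Complex.I • EuclideanSpace.single 1 1)
      < kahlerForm (potential α β) (EuclideanSpace.single 0 1)
        (EuclideanSpace.single 1 1) (Complex.I • EuclideanSpace.single 1 1) := by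
  have ha := weight_pos hα hβ
  have hp : (EuclideanSpace.single 0 1 : C2) ≠ 0 := by simp
  have h0 : kahlerForm (potential α β) (EuclideanSpace.single 0 1)
      (EuclideanSpace.single 1 1) (Complex.I • EuclideanSpace.single 1 1) = 1 / weight α β := by
    rw [kahlerForm_potential hα hβ hp (EuclideanSpace.single 1 1) (t := 1) (e₁ := 1) (e₂ := 1)
      (D := weight α β) (m₁ := 0) (m₂ := 0) rfl rfl
      (potential_eq_of_solves hα hβ hp solvesPotentialEq_one_zero).symm (by simp) (by simp)
      (by simp) ha.ne' (by simp) (by simp)]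
    simp
  rw [h0]
  filter_upwards [eventually_normSq_lt ha] with s hs
  have hz : (EuclideanSpace.single 0 1 + s • EuclideanSpace.single 1 1 : C2) ≠ 0 := by
    intro h
    simpa using congrArg (fun w : C2 => w 0) h
  obtain ⟨ht, heq⟩ := potential_spec hα hβ hz
  have hD0 := weighted_sum_pos ha (weight_pos hβ hα) (Real.rpow_pos_of_pos ht (-weight α β))
    (Real.rpow_pos_of_pos ht (-weight β α)) (sq_nonneg _) (sq_nonneg _) (normSq_coord_pos_or hz)
  have key := transverse_length_lt ha h (weight_add_weight hα hβ) ht rfl rfl hs.1 hs.2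
    (by rw [← heq]; simp; ring) rfl
  rw [kahlerForm_potential hα hβ hz _ rfl rfl rfl rfl rfl rfl hD0.ne' rfl rfl]
  refine lt_of_eq_of_lt ?_ key
  have hns : s.re ^ 2 + s.im ^ 2 = ‖s‖ ^ 2 := by
    rw [← Complex.normSq_eq_norm_sq, Complex.normSq_apply]; ring
  rw [← hns]
  simp
  rw [← hns]
  ring

/-- If `b < 1`, the squared length of `∂/∂z₁` on the line `z₂ = 1` has a strict local maximum at
`z₁ = 0`. -/
lemma eventually_kahlerForm_lt_of_weight_swap_lt_one {α β : ℂ} (hα : 1 < ‖α‖) (hβ : 1 < ‖β‖)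
    (h : weight β α < 1) :
    ∀ᶠ s : ℂ in 𝓝[≠] 0,
      kahlerForm (potential α β) (EuclideanSpace.single 1 1 + s • EuclideanSpace.single 0 1)
        (EuclideanSpace.single 0 1) (Complex.I • EuclideanSpace.single 0 1)
      < kahlerForm (potential α β) (EuclideanSpace.single 1 1)
        (EuclideanSpace.single 0 1) (Complex.I • EuclideanSpace.single 0 1) := by
  have hb := weight_pos hβ hα
  have hp : (EuclideanSpace.single 1 1 : C2) ≠ 0 := by simp
  have h0 : kahlerForm (potential α β) (EuclideanSpace.single 1 1)
      (EuclideanSpace.single 0 1) (Complex.I • EuclideanSpace.single 0 1) = 1 / weight β α := by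
    rw [kahlerForm_potential hα hβ hp (EuclideanSpace.single 0 1) (t := 1) (e₁ := 1) (e₂ := 1)
      (D := weight β α) (m₁ := 0) (m₂ := 0) rfl rfl
      (potential_eq_of_solves hα hβ hp solvesPotentialEq_zero_one).symm (by simp) (by simp)
      (by simp) hb.ne' (by simp) (by simp)]
    simp
  rw [h0]
  filter_upwards [eventually_normSq_lt hb] with s hs
  have hz : (EuclideanSpace.single 1 1 + s • EuclideanSpace.single 0 1 : C2) ≠ 0 := by
    intro h
    simpa using congrArg (fun w : C2 => w 1) h
  obtain ⟨ht, heq⟩ := potential_spec hα hβ hz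
  have hD0 := weighted_sum_pos (weight_pos hα hβ) hb (Real.rpow_pos_of_pos ht (-weight α β))
    (Real.rpow_pos_of_pos ht (-weight β α)) (sq_nonneg _) (sq_nonneg _) (normSq_coord_pos_or hz)
  have key := transverse_length_lt hb h (weight_add_weight hβ hα) ht rfl rfl hs.1 hs.2
    (by rw [← heq]; simp; ring) rfl
  rw [kahlerForm_potential hα hβ hz _ rfl rfl rfl rfl rfl rfl hD0.ne' rfl rfl]
  refine lt_of_eq_of_lt ?_ key
  have hns : s.re ^ 2 + s.im ^ 2 = ‖s‖ ^ 2 := by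
    rw [← Complex.normSq_eq_norm_sq, Complex.normSq_apply]; ring
  rw [← hns]
  simp
  rw [← hns]
  ring

/-- If `|α| ≠ |β|`, then one of the two exponents is less than `1`, and the metric near a point of
the corresponding coordinate axis is not induced by a flat one. -/
theorem norm_eq_of_admitsLocalKahlerImmersion {H : Type*} [NormedAddCommGroup H]
    [InnerProductSpace ℂ H] [CompleteSpace H] {α β : ℂ} (hα : 1 < ‖α‖) (hβ : 1 < ‖β‖)
    (h : AdmitsLocalKahlerImmersion H (potential α β) {z : C2 | z ≠ 0}) : ‖α‖ = ‖β‖ := by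
  have hab := weight_add_weight hα hβ
  rcases lt_trichotomy (weight α β) 1 with h1 | h1 | h1
  · obtain ⟨U, hU, -, F, hF⟩ := h (EuclideanSpace.single 0 1) (by simp)
    exact absurd (eventually_kahlerForm_lt_of_weight_lt_one hα hβ h1) (hF.not_eventually_lt hU _)
  · have h2 := Real.log_pos hα
    have h3 := Real.log_pos hβ
    unfold weight at h1
    rw [div_eq_one_iff_eq (by positivity)] at h1
    exact Real.log_injOn_pos (show 0 < ‖α‖ by linarith) (show 0 < ‖β‖ by linarith) (by linarith)
  · obtain ⟨U, hU, -, F, hF⟩ := h (EuclideanSpace.single 1 1) (by simp)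
    exact absurd (eventually_kahlerForm_lt_of_weight_swap_lt_one hα hβ (by linarith))
      (hF.not_eventually_lt hU _)

/-! ### The flat case -/

lemma weight_eq_one {α β : ℂ} (hα : 1 < ‖α‖) (h : ‖α‖ = ‖β‖) : weight α β = 1 := by
  have h1 := Real.log_pos hα
  unfold weight
  rw [← h]
  field_simp
  ring

lemma potential_eq_normSq {α β : ℂ} (hα : 1 < ‖α‖) (hβ : 1 < ‖β‖) (h : ‖α‖ = ‖β‖) {z : C2}
    (hz : z ≠ 0) : potential α β z = ‖z‖ ^ 2 := by
  refine potential_eq_of_solves hα hβ hz ⟨by positivity, ?_⟩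
  have hz0 : ‖z‖ ^ 2 ≠ 0 := by positivity
  rw [weight_eq_one hα h, weight_eq_one hβ h.symm, Real.rpow_neg_one, ← add_mul,
    ← Fin.sum_univ_two (fun i => ‖z i‖ ^ 2), ← EuclideanSpace.norm_sq_eq, mul_inv_cancel₀ hz0]

lemma kahlerForm_normSq (z v w : C2) :
    kahlerForm (fun z : C2 => ‖z‖ ^ 2) z v w = flatForm v w := by
  let B : C2 →L[ℝ] C2 →L[ℝ] ℝ := 2 • innerSL ℝ
  have h1 : fderiv ℝ (fun z : C2 => ‖z‖ ^ 2) = B :=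
    funext fun z => (hasStrictFDerivAt_norm_sq z).hasFDerivAt.fderiv
  have hB : ∀ v w : C2, B v w = 2 * (inner ℝ (v 0) (w 0) + inner ℝ (v 1) (w 1)) := fun v w => by
    have h2 : B v w = 2 • inner ℝ v w := rfl
    rw [h2, PiLp.inner_apply, Fin.sum_univ_two, two_smul, two_mul]
  unfold kahlerForm flatForm
  rw [h1, B.fderiv, hB, hB]
  simp [PiLp.inner_apply, Fin.sum_univ_two, Complex.inner]
  ring

lemma kahlerForm_potential_of_norm_eq {α β : ℂ} (hα : 1 < ‖α‖) (hβ : 1 < ‖β‖) (h : ‖α‖ = ‖β‖)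
    {z : C2} (hz : z ≠ 0) (v w : C2) : kahlerForm (potential α β) z v w = flatForm v w := by
  have h1 : potential α β =ᶠ[𝓝 z] fun z => ‖z‖ ^ 2 := by
    filter_upwards [isOpen_ne.mem_nhds hz] with x hx
    exact potential_eq_normSq hα hβ h hx
  rw [← kahlerForm_normSq z]
  unfold kahlerForm
  rw [h1.fderiv.fderiv_eq]

section

variable {H : Type*} [NormedAddCommGroup H] [InnerProductSpace ℂ H]

lemma admitsLocalKahlerImmersion_of_linearIsometry {α β : ℂ} (hα : 1 < ‖α‖) (hβ : 1 < ‖β‖)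
    (h : ‖α‖ = ‖β‖) (L : C2 →ₗᵢ[ℂ] H) :
    AdmitsLocalKahlerImmersion H (potential α β) {z : C2 | z ≠ 0} := by
  refine fun p hp => ⟨{z : C2 | z ≠ 0}, hp, subset_rfl, L, isOpen_ne,
    L.toContinuousLinearMap.differentiable.differentiableOn, fun z hz v w => ?_⟩
  rw [kahlerForm_potential_of_norm_eq hα hβ h hz]
  have : fderiv ℂ L z = L.toContinuousLinearMap := L.toContinuousLinearMap.fderiv
  rw [this]
  exact congrArg Complex.im (L.inner_map_map v w)

lemma norm_fderiv_of_norm_eq {α β : ℂ} (hα : 1 < ‖α‖) (hβ : 1 < ‖β‖) (h : ‖α‖ = ‖β‖)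
    {U : Set C2} {F : C2 → H} (hU : U ⊆ {z : C2 | z ≠ 0})
    (hF : IsKahlerImmersionOn (potential α β) U F) {z : C2} (hz : z ∈ U) (v : C2) :
    ‖fderiv ℂ F z v‖ = ‖v‖ := by
  rw [← sq_eq_sq₀ (norm_nonneg _) (norm_nonneg _), hF.normSq_fderiv hz,
    kahlerForm_potential_of_norm_eq hα hβ h (hU hz), flatForm_smul_I]

lemma fderiv_injective_of_norm_eq {α β : ℂ} (hα : 1 < ‖α‖) (hβ : 1 < ‖β‖) (h : ‖α‖ = ‖β‖)
    {U : Set C2} {F : C2 → H} (hU : U ⊆ {z : C2 | z ≠ 0})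
    (hF : IsKahlerImmersionOn (potential α β) U F) {z : C2} (hz : z ∈ U) :
    Function.Injective (fderiv ℂ F z) := by
  refine (injective_iff_map_eq_zero _).2 fun v hv => ?_
  rw [← norm_eq_zero, ← norm_fderiv_of_norm_eq hα hβ h hU hF hz, hv, norm_zero]

end

lemma nonempty_linearIsometry_L2 : Nonempty (C2 →ₗᵢ[ℂ] L2) := by
  refine ⟨⟨(lp.lsingle (𝕜 := ℂ) (E := fun _ : ℕ => ℂ) 2 0) ∘ₗ
      (EuclideanSpace.proj 0 : C2 →L[ℂ] ℂ).toLinearMap +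
    (lp.lsingle (𝕜 := ℂ) (E := fun _ : ℕ => ℂ) 2 1) ∘ₗ
      (EuclideanSpace.proj 1 : C2 →L[ℂ] ℂ).toLinearMap, fun z => ?_⟩⟩
  have h : ‖lp.single (E := fun _ : ℕ => ℂ) 2 0 (z 0) + lp.single 2 1 (z 1)‖ ^ 2 = ‖z‖ ^ 2 := by
    rw [sq, norm_add_sq_eq_norm_sq_add_norm_sq_of_inner_eq_zero _ _ (𝕜 := ℂ)
      (by rw [lp.inner_single_left]; simp), lp.norm_single (by simp), lp.norm_single (by simp),
      EuclideanSpace.norm_sq_eq, Fin.sum_univ_two]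
    ring
  rw [sq_eq_sq₀ (norm_nonneg _) (norm_nonneg _)] at h
  exact h

/-! ### Fullness and rigidity -/

/-- An affine subspace containing the image of an open set contains, in its direction, the range of
the differential, because a finite-dimensional direction is closed. -/
lemma fderiv_mem_direction {U : Set C2} {F : C2 → C2} (hU : IsOpen U)
    (hF : DifferentiableOn ℂ F U) {S : AffineSubspace ℂ C2} (hS : F '' U ⊆ S) {z : C2} (hz : z ∈ U)
    (v : C2) : fderiv ℂ F z v ∈ S.direction := by
  have hz0 : z + (0 : ℂ) • v ∈ U := by simpa using hz
  have hd := hasDerivAt_comp_complexLine hU hF hz0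
  rw [zero_smul, add_zero] at hd
  refine (Submodule.closed_of_finiteDimensional S.direction).mem_of_tendsto
    hd.tendsto_slope ?_
  have hmem := (isOpen_complexLine_preimage hU z v).mem_nhds hz0
  filter_upwards [mem_nhdsWithin_of_mem_nhds hmem] with s hs
  exact S.direction.smul_mem _ (AffineSubspace.vsub_mem_direction (hS ⟨_, hs, rfl⟩)
    (hS ⟨_, hz0, rfl⟩))

theorem isFullOn_of_norm_eq {α β : ℂ} (hα : 1 < ‖α‖) (hβ : 1 < ‖β‖) (h : ‖α‖ = ‖β‖)
    {U : Set C2} {F : C2 → C2} (hne : U.Nonempty) (hU : U ⊆ {z : C2 | z ≠ 0})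
    (hF : IsKahlerImmersionOn (potential α β) U F) : IsFullOn U F := by
  intro S hS
  obtain ⟨z, hz⟩ := hne
  have hsurj : Function.Surjective (fderiv ℂ F z) :=
    LinearMap.surjective_of_injective (f := (fderiv ℂ F z).toLinearMap)
      (fderiv_injective_of_norm_eq hα hβ h hU hF hz)
  have hdir : S.direction = ⊤ := by
    rw [eq_top_iff]
    intro w _
    obtain ⟨v, rfl⟩ := hsurj w
    exact fderiv_mem_direction hF.1 hF.2.1 hS hz v
  exact (AffineSubspace.direction_eq_top_iff_of_nonempty ⟨F z, hS ⟨z, hz, rfl⟩⟩).1 hdir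

section

variable {H : Type*} [NormedAddCommGroup H] [InnerProductSpace ℂ H] [CompleteSpace H]

/-- A holomorphic map with isometric differentials is affine on balls: along each complex line its
derivative is holomorphic of constant norm, hence constant since the target is strictly convex. -/
lemma eq_add_fderiv_of_mem_ball {F : C2 → H} {z : C2} {r : ℝ}
    (hF : DifferentiableOn ℂ F (Metric.ball z r))
    (hiso : ∀ w ∈ Metric.ball z r, ∀ v, ‖fderiv ℂ F w v‖ = ‖v‖) {w : C2}
    (hw : w ∈ Metric.ball z r) : F w = F z + fderiv ℂ F z (w - z) := by
  -- The real inner product provides the strict convexity of `H`.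
  let _ : InnerProductSpace ℝ H := InnerProductSpace.rclikeToReal ℂ H
  set v := w - z with hv
  set V : Set ℂ := {s : ℂ | z + s • v ∈ Metric.ball z r} with hV
  have hVo : IsOpen V := isOpen_complexLine_preimage Metric.isOpen_ball z v
  have hVc : Convex ℝ V := by
    have : V = (fun s : ℂ => s • v) ⁻¹' (Metric.ball 0 r) := by
      ext s
      simp [hV, Metric.mem_ball, dist_eq_norm]
    rw [this]
    exact (convex_ball (0 : C2) r).is_linear_preimage
      ((LinearMap.toSpanSingleton ℂ C2 v).restrictScalars ℝ).isLinear
  have h0 : (0 : ℂ) ∈ V := by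
    have : 0 < r := dist_nonneg.trans_lt hw
    simpa [hV] using this
  have h1 : (1 : ℂ) ∈ V := by simpa [hV, hv, dist_eq_norm] using hw
  have hconst := Complex.eqOn_of_isPreconnected_of_isMaxOn_norm hVc.isPreconnected hVo
    (differentiableOn_fderiv_comp_complexLine Metric.isOpen_ball hF z v) h0
    (fun s hs => by simp only [Set.mem_ofPred_eq, Function.comp_apply]; rw [hiso _ hs, hiso _ h0])
  have heq := hVo.eqOn_of_deriv_eq (f := fun s : ℂ => F (z + s • v))
    (g := fun s : ℂ => F z + s • fderiv ℂ F z v) hVc.isPreconnected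
    (fun s hs => (hasDerivAt_comp_complexLine Metric.isOpen_ball hF hs).differentiableAt
      |>.differentiableWithinAt) (by fun_prop)
    (fun s hs => by
      rw [(hasDerivAt_comp_complexLine Metric.isOpen_ball hF hs).deriv]
      have h2 : HasDerivAt (fun s : ℂ => F z + s • fderiv ℂ F z v) (fderiv ℂ F z v) s := by
        simpa using ((hasDerivAt_id s).smul_const (fderiv ℂ F z v)).const_add (F z)
      rw [h2.deriv]
      simpa using hconst hs) h0 (by simp) h1
  simpa [hv] using heq

/-- A holomorphic map with isometric differentials on a connected open set is affine. -/
lemma exists_eq_add_clm {U : Set C2} (hU : IsOpen U) (hc : IsPreconnected U) {F : C2 → H}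
    (hF : DifferentiableOn ℂ F U) (hiso : ∀ w ∈ U, ∀ v, ‖fderiv ℂ F w v‖ = ‖v‖) {z₀ : C2}
    (hz₀ : z₀ ∈ U) : ∀ z ∈ U, F z = F z₀ + fderiv ℂ F z₀ (z - z₀) := by
  have hloc : ∀ z ∈ U, ∀ᶠ w in 𝓝 z, fderiv ℂ F w = fderiv ℂ F z := by
    intro z hz
    obtain ⟨r, hr, hball⟩ := Metric.isOpen_iff.1 hU z hz
    filter_upwards [Metric.ball_mem_nhds z hr] with w hw
    have : F =ᶠ[𝓝 w] fun w => F z + fderiv ℂ F z (w - z) := by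
      filter_upwards [Metric.isOpen_ball.mem_nhds hw] with x hx
      exact eq_add_fderiv_of_mem_ball (hF.mono hball) (fun y hy => hiso y (hball hy)) hx
    rw [this.fderiv_eq]
    exact (((fderiv ℂ F z).hasFDerivAt.comp w ((hasFDerivAt_id w).sub_const z)).const_add
      (F z)).fderiv
  have hzero : ∀ z ∈ U, HasFDerivAt (𝕜 := ℂ) (fderiv ℂ F) 0 z := fun z hz =>
    (hasFDerivAt_const (fderiv ℂ F z) z).congr_of_eventuallyEq (hloc z hz)
  have hconst : ∀ z ∈ U, fderiv ℂ F z = fderiv ℂ F z₀ := fun z hz =>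
    hU.is_const_of_fderiv_eq_zero (𝕜 := ℂ) (f := fderiv ℂ F) hc
      (fun x hx => (hzero x hx).differentiableAt.differentiableWithinAt)
      (fun x hx => (hzero x hx).fderiv) hz hz₀
  have hg : ∀ z : C2, HasFDerivAt (fun z => F z₀ + fderiv ℂ F z₀ (z - z₀)) (fderiv ℂ F z₀) z :=
    fun z => ((fderiv ℂ F z₀).hasFDerivAt.comp z ((hasFDerivAt_id z).sub_const z₀)).const_add
      (F z₀)
  exact hU.eqOn_of_fderiv_eq hc hF (fun z _ => (hg z).differentiableAt.differentiableWithinAt)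
    (fun z hz => by rw [hconst z hz, (hg z).fderiv]) hz₀ (by simp)

end

lemma finrank_direction_affineSpan_image {V W : Type*} [NormedAddCommGroup V] [NormedSpace ℂ V]
    [NormedAddCommGroup W] [NormedSpace ℂ W] {U : Set V} (hU : IsOpen U) {z₀ : V} (hz₀ : z₀ ∈ U)
    {F : V → W} {L : V →ₗ[ℂ] W} (hL : Function.Injective L)
    (hF : ∀ z ∈ U, F z = F z₀ + L (z - z₀)) :
    Module.finrank ℂ (affineSpan ℂ (F '' U)).direction = Module.finrank ℂ V := by
  suffices h : (affineSpan ℂ (F '' U)).direction = LinearMap.range L by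
    rw [h, LinearMap.finrank_range_of_inj hL]
  rw [direction_affineSpan]
  apply le_antisymm
  · rw [vectorSpan_def, Submodule.span_le]
    rintro _ ⟨_, ⟨x, hx, rfl⟩, _, ⟨y, hy, rfl⟩, rfl⟩
    refine ⟨x - y, ?_⟩
    simp only [hF x hx, hF y hy, vsub_eq_sub, map_sub]
    abel
  · rintro _ ⟨v, rfl⟩
    have hcont : Tendsto (fun s : ℂ => z₀ + s • v) (𝓝[≠] 0) (𝓝 z₀) := by
      have : Continuous fun s : ℂ => z₀ + s • v := by fun_prop
      simpa using (this.tendsto 0).mono_left nhdsWithin_le_nhds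
    obtain ⟨s, hs, hs0⟩ :=
      ((hcont.eventually (hU.mem_nhds hz₀)).and self_mem_nhdsWithin).exists
    have h1 := vsub_mem_vectorSpan ℂ (Set.mem_image_of_mem F hs) (Set.mem_image_of_mem F hz₀)
    rw [vsub_eq_sub, hF _ hs, add_sub_cancel_left, add_sub_cancel_left, map_smul] at h1
    exact (Submodule.smul_mem_iff _ hs0).1 h1

theorem finrank_direction_of_norm_eq {H : Type*} [NormedAddCommGroup H] [InnerProductSpace ℂ H]
    [CompleteSpace H] {α β : ℂ} (hα : 1 < ‖α‖) (hβ : 1 < ‖β‖) (h : ‖α‖ = ‖β‖)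
    {U : Set C2} {F : C2 → H} (hne : U.Nonempty) (hc : IsPreconnected U)
    (hU : U ⊆ {z : C2 | z ≠ 0}) (hF : IsKahlerImmersionOn (potential α β) U F) :
    Module.finrank ℂ (affineSpan ℂ (F '' U)).direction = 2 := by
  obtain ⟨z₀, hz₀⟩ := hne
  rw [finrank_direction_affineSpan_image hF.1 hz₀ (L := (fderiv ℂ F z₀).toLinearMap)
    (fderiv_injective_of_norm_eq hα hβ h hU hF hz₀)
    (exists_eq_add_clm hF.1 hc hF.2.1
      (fun w hw v => norm_fderiv_of_norm_eq hα hβ h hU hF hw v) hz₀)]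
  simp

end GauduchonOrnea

open GauduchonOrnea in
theorem mainTheorem3 (α β : ℂ) (hα : 1 < ‖α‖) (hβ : 1 < ‖β‖) :
    IsKahlerPotentialOn (potential α β) {z : C2 | z ≠ 0} ∧
    (AdmitsLocalKahlerImmersion L2 (potential α β) {z : C2 | z ≠ 0} ↔ ‖α‖ = ‖β‖) ∧
    (‖α‖ = ‖β‖ →
      AdmitsLocalKahlerImmersion C2 (potential α β) {z : C2 | z ≠ 0} ∧
      (∀ (U : Set C2) (F : C2 → C2), U.Nonempty → U ⊆ {z : C2 | z ≠ 0} →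
        IsKahlerImmersionOn (potential α β) U F → IsFullOn U F) ∧
      (∀ (U : Set C2) (F : C2 → L2), U.Nonempty → IsPreconnected U → U ⊆ {z : C2 | z ≠ 0} →
        IsKahlerImmersionOn (potential α β) U F →
        Module.finrank ℂ (affineSpan ℂ (F '' U)).direction = 2)) := by
  refine ⟨isKahlerPotentialOn_potential hα hβ,
    ⟨norm_eq_of_admitsLocalKahlerImmersion hα hβ, fun h => ?_⟩, fun h => ⟨?_, ?_, ?_⟩⟩
  · obtain ⟨L⟩ := nonempty_linearIsometry_L2
    exact admitsLocalKahlerImmersion_of_linearIsometry hα hβ h L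
  · exact admitsLocalKahlerImmersion_of_linearIsometry hα hβ h LinearIsometry.id
  · exact fun U F hne hU hF => isFullOn_of_norm_eq hα hβ h hne hU hF
  · exact fun U F hne hc hU hF => finrank_direction_of_norm_eq hα hβ h hne hc hU hF
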